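/- For a function $P$ of $n$ complex variables and an integer $k\ge 0$ let $$\mu_k(P)=\int_0^1\!\cdots\!\int_0^1 \log^k\bigl|P(e^{2\pi i t_1},\dots,e^{2\pi i t_n})\bigr|\,dt_1\cdots dt_n$$ be the $k$-th higher Mahler measure of $P$ (so $\mu_0(P)=1$), and for complex $s$ let $$W_3(s)=\int_0^1\!\int_0^1\!\int_0^1 \bigl|e^{2\pi i t_1}+e^{2\pi i t_2}+e^{2\pi i t_3}\bigr|^s\,dt_1\,dt_2\,dt_3$$ be the $s$-th moment of a three-step uniform random walk in the plane. Then, for every integer $m\ge 0$, the integral defining $\mu_m(1+x+y)$ converges absolutely, and for every complex $s$ with $|s|<2$ the integral defining $W_3(s)$ converges absolutely, both series below converge absolutely, and $$\sum_{m=0}^\infty \mu_m(1+x+y)\,\frac{s^m}{m!} = W_3(s)=\frac{\sqrt3}{2\pi}\,3^{s+1}\,\frac{\Gamma(1+s/2)^2}{\Gamma(s+2)}\;{}_3F_2\!\left(\tfrac{s+2}2,\tfrac{s+2}2,\tfrac{s+2}2;\,1,\tfrac{s+3}2;\,\tfrac14\right),$$ where ${}_3F_2(a_1,a_2,a_3;b_1,b_2;z)=\sum_{m\ge0}\frac{(a_1)_m(a_2)_m(a_3)_m}{(b_1)_m(b_2)_m}\frac{z^m}{m!}$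 with $(a)_m=a(a+1)\cdots(a+m-1)$. In other words, $W_3$ is the exponential generating function of the higher Mahler measures of $1+x+y$. -/

import Mathlib

open MeasureTheory

/-- The point `(e^{2πi t₁}, …, e^{2πi tₙ})` of the torus with angle parameters `t`. -/
noncomputable def torusPoint {n : ℕ} (t : Fin n → ℝ) : Fin n → ℂ :=
  fun j => Complex.exp (2 * (Real.pi : ℂ) * Complex.I * ((t j : ℝ) : ℂ))

/-- The integrand `∏ⱼ log |Pⱼ(e^{2πi t₁}, …, e^{2πi tₙ})|` of the multiple Mahler measure. -/
noncomputable def mahlerIntegrand {n k : ℕ} (P : Fin k → (Fin n → ℂ) → ℂ) (t : Fin n → ℝ) : ℝ :=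
  ∏ j, Real.log ‖P j (torusPoint t)‖

/-- The multiple Mahler measure `μ(P₁, …, Pₖ)` of `k` functions in `n` variables: the integral of
`∏ⱼ log |Pⱼ(e^{2πi t₁}, …, e^{2πi tₙ})|` over the unit cube `[0,1]ⁿ`. -/
noncomputable def multipleMahlerMeasure {n k : ℕ} (P : Fin k → (Fin n → ℂ) → ℂ) : ℝ :=
  ∫ t in Set.Icc (0 : Fin n → ℝ) 1, mahlerIntegrand P t

/-- The higher Mahler measure `μₖ(P) = μ(P, …, P)` (`k` copies of `P`). -/
noncomputable def higherMahlerMeasure {n : ℕ} (k : ℕ) (P : (Fin n → ℂ) → ℂ) : ℝ :=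
  multipleMahlerMeasure (fun _ : Fin k => P)

/-- The integrand `|∑ₖ e^{2πi tₖ}|^s` of the `s`-th moment of an `n`-step random walk. -/
noncomputable def walkIntegrand (n : ℕ) (s : ℂ) (t : Fin n → ℝ) : ℂ :=
  ((‖∑ j, torusPoint t j‖ : ℝ) : ℂ) ^ s

/-- The `s`-th moment `Wₙ(s)` of an `n`-step uniform random walk in the plane. -/
noncomputable def walkMoment (n : ℕ) (s : ℂ) : ℂ :=
  ∫ t in Set.Icc (0 : Fin n → ℝ) 1, walkIntegrand n s t

/-- The `m`-th term `(a₁)ₘ ⋯ (aₚ)ₘ / ((b₁)ₘ ⋯ (b_q)ₘ) · zᵐ / m!` of the generalized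
hypergeometric series; `(x)ₘ = x (x + 1) ⋯ (x + m - 1)` is the Pochhammer symbol. -/
noncomputable def hypergeometricTerm (a b : List ℂ) (z : ℂ) (m : ℕ) : ℂ :=
  (a.map fun x => (ascPochhammer ℂ m).eval x).prod /
    (b.map fun x => (ascPochhammer ℂ m).eval x).prod * z ^ m / (m.factorial : ℂ)

/-- The generalized hypergeometric function `pFq(a₁, …, aₚ; b₁, …, b_q; z)`, as the sum of its
defining series. -/
noncomputable def generalizedHypergeometric (a b : List ℂ) (z : ℂ) : ℂ :=
  ∑' m, hypergeometricTerm a b z m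

/-! Both `|1 + x + y|²` and `|x + y + z|²` on the torus turn out to have one and the same explicit
law, and everything is read off from that law.

The law is found backwards from the hypergeometric side. Put `a = 1 + s/2`, `q = u(1-u)` and `K = |1
- √q e^{2πit}|²`. Parseval for the binomial series of `(1 - √q z)^(-a)`, followed by a beta integral
in `u`, gives `∬ q^(a-1) K^(-a) = ∑ ((a)ₘ/m!)² B(a+m, a+m)` for `Re a > 0` (`hasSum_poisson_beta`),
and the sum is the ₃F₂ up to Gamma factors. The integrand is, up to a constant and `3^s`, the
function `V^(s/2)` with `V = 9q/K` against a density proportional to `1/K`. So the right-hand side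
is the moment function of a positive measure, `threeStepLaw`, carried by `(0, 9]`.

To identify this measure with the law of the walk it suffices to compare integer moments of the
squared length, since a measure on a bounded interval is determined by its moments. For the walk,
Parseval gives `∑ⱼ C(k,j)² C(2j,j)`; for the explicit law the series at `a = k + 1` is `∑ₘ
momentTerm k m`. Creative telescoping gives both the same second-order recurrence, and the cases `k
= 0, 1` agree (`threeStepMoment_eq`).

Finally, since the explicit law has finite moments for `Re s > -2`, `exp(c |log √v|)` is integrable
for `0 ≤ c < 2`, and the exponential series of `v^(s/2)` may be integrated term by term when `|s| <
2`. -/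

/-! ### Parseval on the circle and the even moments of the walk. -/

/-- The point `e^{2πit}` of the unit circle. -/
noncomputable def unitExp (t : ℝ) : ℂ := Complex.exp (2 * (Real.pi : ℂ) * Complex.I * (t : ℂ))

@[fun_prop]
theorem continuous_unitExp : Continuous unitExp := by unfold unitExp; fun_prop

theorem norm_unitExp (t : ℝ) : ‖unitExp t‖ = 1 := by
  have : 2 * (Real.pi : ℂ) * Complex.I * (t : ℂ) = ((2 * Real.pi * t : ℝ) : ℂ) * Complex.I := by
    push_cast; ring
  rw [unitExp, this, Complex.norm_exp_ofReal_mul_I]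

theorem conj_unitExp (t : ℝ) :
    (starRingEnd ℂ) (unitExp t) = Complex.exp (-(2 * (Real.pi : ℂ) * Complex.I * (t : ℂ))) := by
  rw [unitExp, ← Complex.exp_conj]
  simp [Complex.conj_ofNat]

theorem integral_unitExp_pow_mul_conj_pow (m n : ℕ) :
    ∫ t in Set.Icc (0 : ℝ) 1, unitExp t ^ m * (starRingEnd ℂ) (unitExp t) ^ n =
      if m = n then 1 else 0 := by
  have h : ∀ t : ℝ, unitExp t ^ m * (starRingEnd ℂ) (unitExp t) ^ n =
      Complex.exp ((2 * (Real.pi : ℂ) * Complex.I * ((m : ℂ) - n)) * (t : ℂ)) := by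
    intro t
    rw [conj_unitExp, unitExp, ← Complex.exp_nat_mul, ← Complex.exp_nat_mul, ← Complex.exp_add]
    congr 1; ring
  simp_rw [h]
  rw [integral_Icc_eq_integral_Ioc, ← intervalIntegral.integral_of_le zero_le_one]
  split_ifs with hmn
  · simp [hmn]
  · have hc : 2 * (Real.pi : ℂ) * Complex.I * ((m : ℂ) - n) ≠ 0 := by
      have : (m : ℂ) - n ≠ 0 := by rw [sub_ne_zero]; exact_mod_cast hmn
      simp [Real.pi_ne_zero, this]
    rw [integral_exp_mul_complex hc]
    have : Complex.exp (2 * (Real.pi : ℂ) * Complex.I * ((m : ℂ) - n) * ((1 : ℝ) : ℂ)) = 1 := by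
      rw [Complex.exp_eq_one_iff]
      exact ⟨(m : ℤ) - n, by push_cast; ring⟩
    rw [this]; simp

theorem integral_tsum_mul_tsum_conj {a b : ℕ → ℂ} (ha : Summable fun n => ‖a n‖)
    (hb : Summable fun n => ‖b n‖) :
    ∫ t in Set.Icc (0 : ℝ) 1, (∑' n, a n * unitExp t ^ n) *
        (∑' n, b n * (starRingEnd ℂ) (unitExp t) ^ n) = ∑' n, a n * b n := by
  have hprod : ∀ t : ℝ, (∑' n, a n * unitExp t ^ n) *
      (∑' n, b n * (starRingEnd ℂ) (unitExp t) ^ n) =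
      ∑' p : ℕ × ℕ, a p.1 * b p.2 * (unitExp t ^ p.1 * (starRingEnd ℂ) (unitExp t) ^ p.2) := by
    intro t
    rw [tsum_mul_tsum_of_summable_norm]
    · refine tsum_congr fun p => by ring
    · simpa [norm_unitExp] using ha
    · simpa [norm_unitExp] using hb
  simp_rw [hprod]
  have hint : ∀ p : ℕ × ℕ, Integrable (fun t : ℝ => a p.1 * b p.2 *
      (unitExp t ^ p.1 * (starRingEnd ℂ) (unitExp t) ^ p.2))
      (volume.restrict (Set.Icc (0 : ℝ) 1)) := fun p =>
    (Continuous.continuousOn (by fun_prop)).integrableOn_compact isCompact_Icc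
  rw [← integral_tsum_of_summable_integral_norm hint]
  · simp_rw [integral_const_mul, integral_unitExp_pow_mul_conj_pow]
    rw [← Function.Injective.tsum_eq (g := fun n : ℕ => (n, n))]
    · simp
    · intro m n h; simpa using h
    · rintro ⟨m, n⟩ h
      simp only [Function.mem_support, ne_eq, mul_ite, mul_one, mul_zero, ite_eq_right_iff,
        Classical.not_imp] at h
      exact ⟨m, by simp [h.1]⟩
  · simp only [norm_mul, norm_pow, norm_unitExp, RCLike.norm_conj, one_pow, mul_one]
    simpa using ha.mul_of_nonneg hb (fun _ => norm_nonneg _) (fun _ => norm_nonneg _)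

/-- Parseval applied to the polynomial `(z + w)^k` in `w`, whose coefficients are `C(k,j) z^(k-j)`.
-/
theorem integral_norm_add_unitExp_pow (z : ℂ) (k : ℕ) :
    ∫ t in Set.Icc (0 : ℝ) 1, (‖z + unitExp t‖ ^ 2) ^ k =
      ∑ j ∈ Finset.range (k + 1), (k.choose j : ℝ) ^ 2 * (‖z‖ ^ 2) ^ (k - j) := by
  let a : ℕ → ℂ := fun j => (k.choose j : ℂ) * z ^ (k - j)
  have ha0 : ∀ j ∉ Finset.range (k + 1), a j = 0 := fun j hj => by
    simp only [Finset.mem_range, not_lt] at hj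
    simp [a, Nat.choose_eq_zero_of_lt (show k < j by omega)]
  have ha : Summable fun n => ‖a n‖ :=
    summable_of_ne_finset_zero (s := Finset.range (k + 1)) fun j hj => by simp [ha0 j hj]
  have hb : Summable fun n => ‖(starRingEnd ℂ) (a n)‖ := by simpa using ha
  have hexp : ∀ t, (z + unitExp t) ^ k = ∑' n, a n * unitExp t ^ n := fun t => by
    rw [tsum_eq_sum (s := Finset.range (k + 1)) fun j hj => by simp [ha0 j hj], add_comm, add_pow]
    exact Finset.sum_congr rfl fun j _ => by simp only [a]; ring
  have hexp' : ∀ t, (starRingEnd ℂ) (z + unitExp t) ^ k =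
      ∑' n, (starRingEnd ℂ) (a n) * (starRingEnd ℂ) (unitExp t) ^ n := fun t => by
    rw [← map_pow, hexp, Complex.conj_tsum]
    simp
  have key := integral_tsum_mul_tsum_conj ha hb
  simp_rw [← hexp, ← hexp', ← mul_pow, Complex.mul_conj, Complex.normSq_eq_norm_sq] at key
  rw [tsum_eq_sum (s := Finset.range (k + 1)) fun j hj => by simp [ha0 j hj]] at key
  have : ∀ t : ℝ, (((‖z + unitExp t‖ ^ 2 : ℝ) : ℂ)) ^ k = (((‖z + unitExp t‖ ^ 2) ^ k : ℝ) : ℂ) :=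
    fun t => by push_cast; rfl
  simp_rw [this] at key
  rw [integral_complex_ofReal] at key
  apply Complex.ofReal_injective
  rw [key]
  push_cast
  refine Finset.sum_congr rfl fun j _ => ?_
  simp only [a, ← pow_mul, norm_mul, norm_pow, RCLike.norm_natCast]
  push_cast
  ring

/-- The even moments `∑ⱼ C(k,j)² C(2j,j)` of a three-step planar random walk. -/
def threeStepMoment (k : ℕ) : ℝ :=
  ∑ j ∈ Finset.range (k + 1), (k.choose j : ℝ) ^ 2 * (j.centralBinom : ℝ)

theorem integral_norm_add_unitExp_pow_of_norm_eq_one {z : ℂ} (hz : ‖z‖ = 1) (k : ℕ) :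
    ∫ t in Set.Icc (0 : ℝ) 1, (‖z + unitExp t‖ ^ 2) ^ k = k.centralBinom := by
  rw [integral_norm_add_unitExp_pow, Nat.centralBinom_eq_two_mul_choose, ← Nat.sum_range_choose_sq]
  simp [hz]

theorem integral_integral_norm_add_unitExp_pow {z : ℂ} (hz : ‖z‖ = 1) (k : ℕ) :
    ∫ u in Set.Icc (0 : ℝ) 1, ∫ t in Set.Icc (0 : ℝ) 1, (‖z + unitExp u + unitExp t‖ ^ 2) ^ k =
      threeStepMoment k := by
  simp_rw [integral_norm_add_unitExp_pow]
  rw [integral_finsetSum]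
  · simp_rw [integral_const_mul, integral_norm_add_unitExp_pow_of_norm_eq_one hz]
    -- The inner integral leaves `‖z + unitExp u‖ ^ (2(k-j))`, so the central binomial appears at `k
    -- - j`; the sum is reflected.
    rw [threeStepMoment, ← Finset.sum_range_reflect]
    refine Finset.sum_congr rfl fun j hj => ?_
    have : j ≤ k := by simpa [Nat.lt_succ_iff] using hj
    simp [Nat.choose_symm this, Nat.sub_sub_self this]
  · intro j _
    exact (Continuous.continuousOn (by fun_prop)).integrableOn_compact isCompact_Icc

theorem volume_restrict_Icc_zero_one (n : ℕ) :
    (volume : Measure (Fin n → ℝ)).restrict (Set.Icc 0 1) =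
      Measure.pi fun _ => volume.restrict (Set.Icc (0 : ℝ) 1) := by
  rw [volume_pi, ← Measure.restrict_pi_pi, ← Set.pi_univ_Icc]
  rfl

theorem integral_Icc_fin_succ {n : ℕ} {f : (Fin (n + 1) → ℝ) → ℝ} (hf : Continuous f) :
    ∫ t in Set.Icc (0 : Fin (n + 1) → ℝ) 1, f t =
      ∫ x in Set.Icc (0 : ℝ) 1, ∫ t in Set.Icc (0 : Fin n → ℝ) 1, f (Fin.cons x t) := by
  have hint : IntegrableOn f (Set.Icc (0 : Fin (n + 1) → ℝ) 1) :=
    hf.continuousOn.integrableOn_compact isCompact_Icc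
  rw [IntegrableOn, volume_restrict_Icc_zero_one] at hint
  have hmp := (measurePreserving_piFinSuccAbove
    (fun _ : Fin (n + 1) => volume.restrict (Set.Icc (0 : ℝ) 1)) 0).symm
  have hemb := (MeasurableEquiv.piFinSuccAbove (fun _ : Fin (n + 1) => ℝ) 0).symm.measurableEmbedding
  rw [volume_restrict_Icc_zero_one, volume_restrict_Icc_zero_one, ← hmp.integral_comp hemb,
    integral_prod]
  · simp only [MeasurableEquiv.piFinSuccAbove_symm_apply, Fin.insertNthEquiv_zero]
    rfl
  · exact (hmp.integrable_comp_emb hemb).2 hint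

theorem integral_Icc_fin_zero (f : (Fin 0 → ℝ) → ℝ) :
    ∫ t in Set.Icc (0 : Fin 0 → ℝ) 1, f t = f ![] := by
  rw [volume_restrict_Icc_zero_one, Measure.pi_of_empty, integral_dirac]
  exact congrArg f (Subsingleton.elim _ _)

theorem integral_norm_one_add_torusPoint_pow (k : ℕ) :
    ∫ t in Set.Icc (0 : Fin 2 → ℝ) 1, (‖1 + torusPoint t 0 + torusPoint t 1‖ ^ 2) ^ k =
      threeStepMoment k := by
  change ∫ t in Set.Icc (0 : Fin 2 → ℝ) 1, (‖1 + unitExp (t 0) + unitExp (t 1)‖ ^ 2) ^ k = _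
  rw [integral_Icc_fin_succ (by fun_prop),
    ← integral_integral_norm_add_unitExp_pow (norm_one (α := ℂ))]
  refine integral_congr_ae (Filter.Eventually.of_forall fun x => ?_)
  simp only
  rw [integral_Icc_fin_succ (by fun_prop)]
  simp_rw [integral_Icc_fin_zero]
  rfl

theorem integral_norm_sum_torusPoint_pow (k : ℕ) :
    ∫ t in Set.Icc (0 : Fin 3 → ℝ) 1, (‖∑ j, torusPoint t j‖ ^ 2) ^ k = threeStepMoment k := by
  simp_rw [Fin.sum_univ_three]
  change ∫ t in Set.Icc (0 : Fin 3 → ℝ) 1,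
    (‖unitExp (t 0) + unitExp (t 1) + unitExp (t 2)‖ ^ 2) ^ k = _
  rw [integral_Icc_fin_succ (by fun_prop)]
  -- The double integral depends on the first step only through its modulus 1, so the third
  -- integration is over a constant.
  have : ∀ z : ℝ, ∫ t in Set.Icc (0 : Fin 2 → ℝ) 1,
      (‖unitExp z + unitExp (t 0) + unitExp (t 1)‖ ^ 2) ^ k = threeStepMoment k := by
    intro z
    rw [integral_Icc_fin_succ (by fun_prop),
      ← integral_integral_norm_add_unitExp_pow (norm_unitExp z)]
    refine integral_congr_ae (Filter.Eventually.of_forall fun x => ?_)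
    simp only
    rw [integral_Icc_fin_succ (by fun_prop)]
    simp_rw [integral_Icc_fin_zero]
    rfl
  refine (integral_congr_ae (Filter.Eventually.of_forall this)).trans ?_
  simp

/-! ### Determinacy of the moment problem on a bounded interval. -/

/-- Two finite measures on a bounded interval that have the same moments are equal. -/
theorem MeasureTheory.Measure.ext_of_integral_pow_eq {μ ν : Measure ℝ} [IsFiniteMeasure μ]
    [IsFiniteMeasure ν] {a b : ℝ} (hμ : ∀ᵐ x ∂μ, x ∈ Set.Icc a b)
    (hν : ∀ᵐ x ∂ν, x ∈ Set.Icc a b) (h : ∀ k : ℕ, ∫ x, x ^ k ∂μ = ∫ x, x ^ k ∂ν) : μ = ν := by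
  have hbdd : ∀ {ρ : Measure ℝ} [IsFiniteMeasure ρ], (∀ᵐ x ∂ρ, x ∈ Set.Icc a b) →
      ∀ f : ℝ → ℝ, Continuous f → Integrable f ρ := by
    intro ρ _ hρ f hf
    obtain ⟨C, hC⟩ := (isCompact_Icc (a := a) (b := b)).exists_bound_of_continuousOn hf.continuousOn
    exact Integrable.of_bound hf.aestronglyMeasurable C (hρ.mono fun x hx => hC x hx)
  have hpoly : ∀ p : Polynomial ℝ, ∫ x, p.eval x ∂μ = ∫ x, p.eval x ∂ν := by
    intro p
    simp_rw [Polynomial.eval_eq_sum_range]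
    rw [integral_finsetSum _ fun i _ => hbdd hμ _ (by fun_prop),
      integral_finsetSum _ fun i _ => hbdd hν _ (by fun_prop)]
    simp_rw [integral_const_mul, h]
  refine ext_of_forall_integral_eq_of_IsFiniteMeasure fun f => ?_
  refine eq_of_forall_dist_le fun ε hε => ?_
  -- The `+ 1` keeps `M` positive when both measures vanish; Weierstrass approximation within `ε /
  -- M` then costs at most `ε` in total.
  set M := μ.real Set.univ + ν.real Set.univ + 1 with hM
  have hMpos : 0 < M := by positivity
  obtain ⟨p, hp⟩ := exists_polynomial_near_of_continuousOn a b f f.continuous.continuousOn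
    (ε / M) (by positivity)
  have hclose : ∀ {ρ : Measure ℝ} [IsFiniteMeasure ρ], (∀ᵐ x ∂ρ, x ∈ Set.Icc a b) →
      dist (∫ x, f x ∂ρ) (∫ x, p.eval x ∂ρ) ≤ ε / M * ρ.real Set.univ := by
    intro ρ _ hρ
    rw [dist_eq_norm, ← integral_sub (hbdd hρ _ f.continuous) (hbdd hρ _ (by fun_prop))]
    refine norm_integral_le_of_norm_le_const (hρ.mono fun x hx => ?_)
    rw [norm_sub_rev]
    exact (hp x hx).le
  calc dist (∫ x, f x ∂μ) (∫ x, f x ∂ν)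
      ≤ dist (∫ x, f x ∂μ) (∫ x, p.eval x ∂μ) + dist (∫ x, f x ∂ν) (∫ x, p.eval x ∂μ) :=
        dist_triangle_right _ _ _
    _ ≤ ε / M * μ.real Set.univ + ε / M * ν.real Set.univ := by
        rw [hpoly p]
        gcongr
        · rw [← hpoly p]; exact hclose hμ
        · exact hclose hν
    _ ≤ ε / M * M := by rw [← mul_add]; gcongr; rw [hM]; linarith
    _ = ε := by field_simp
-- Recurrence for the moments of the walk.
theorem threeStepMoment_recurrence (k : ℕ) :
    ((k : ℝ) + 2) ^ 2 * threeStepMoment (k + 2) - (10 * k ^ 2 + 30 * k + 23) * threeStepMoment (k + 1)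
      + 9 * (k + 1) ^ 2 * threeStepMoment k = 0 := by
  have hext : ∀ n N : ℕ, n ≤ N → threeStepMoment n =
      ∑ j ∈ Finset.range (N + 1), (n.choose j : ℝ) ^ 2 * (j.centralBinom : ℝ) := by
    intro n N h
    refine Finset.sum_subset (Finset.range_mono (by omega)) fun j _ hj => ?_
    simp only [Finset.mem_range, not_lt] at hj
    simp [Nat.choose_eq_zero_of_lt (show n < j by omega)]
  rw [hext k (k + 2) (by omega), hext (k + 1) (k + 2) (by omega), hext (k + 2) (k + 2) le_rfl]
  -- A creative-telescoping certificate: it vanishes at `j = 0` through `j ^ 3` and at `j = k + 3`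
  -- through the binomial.
  let G : ℕ → ℝ := fun j => ((k + 2).choose j : ℝ) ^ 2 * (j.centralBinom : ℝ) * j ^ 3 *
    (3 * j - 4 * k - 8) / (k + 2) ^ 2
  have hG : ∀ j ∈ Finset.range (k + 2 + 1), ((k : ℝ) + 2) ^ 2 *
      (((k + 2).choose j : ℝ) ^ 2 * (j.centralBinom : ℝ)) - (10 * k ^ 2 + 30 * k + 23) *
      (((k + 1).choose j : ℝ) ^ 2 * (j.centralBinom : ℝ)) + 9 * (k + 1) ^ 2 *
      ((k.choose j : ℝ) ^ 2 * (j.centralBinom : ℝ)) = G (j + 1) - G j := by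
    intro j hj
    have hjk : j ≤ k + 2 := by simpa [Nat.lt_succ_iff] using hj
    have h1 : ((k + 1).choose j : ℝ) = (k + 2).choose j * (k + 2 - j) / (k + 2) := by
      have := Nat.choose_mul_succ_eq (k + 1) j
      rw [eq_div_iff (by positivity)]
      have h := congrArg (Nat.cast (R := ℝ)) this
      rw [Nat.cast_mul, Nat.cast_mul, Nat.cast_sub (by omega)] at h
      push_cast at h
      linear_combination h
    have h2 : (k.choose j : ℝ) * (k + 1) = (k + 1).choose j * (k + 1 - j) := by
      -- For `j = k + 2` the natural subtraction truncates and its cast is unusable, but both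
      -- binomials are zero.
      rcases Nat.lt_or_ge (k + 1) j with hlt | hle
      · simp [Nat.choose_eq_zero_of_lt hlt, Nat.choose_eq_zero_of_lt (show k < j by omega)]
      have h := congrArg (Nat.cast (R := ℝ)) (Nat.choose_mul_succ_eq k j)
      rw [Nat.cast_mul, Nat.cast_mul, Nat.cast_sub (by omega)] at h
      push_cast at h
      linear_combination h
    have h2' : (k.choose j : ℝ) = (k + 2).choose j * (k + 2 - j) / (k + 2) * (k + 1 - j) / (k + 1) := by
      rw [← h1, ← h2]; field_simp
    have h3 : ((k + 2).choose (j + 1) : ℝ) = (k + 2).choose j * (k + 2 - j) / (j + 1) := by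
      have h := congrArg (Nat.cast (R := ℝ)) (Nat.choose_succ_right_eq (k + 2) j)
      rw [Nat.cast_mul, Nat.cast_mul, Nat.cast_sub (by omega)] at h
      push_cast at h
      rw [eq_div_iff (by positivity)]
      linear_combination h
    have h4 : ((j + 1).centralBinom : ℝ) = 2 * (2 * j + 1) * j.centralBinom / (j + 1) := by
      have h := congrArg (Nat.cast (R := ℝ)) (Nat.succ_mul_centralBinom_succ j)
      push_cast at h
      rw [eq_div_iff (by positivity)]
      linear_combination h
    simp only [G]
    rw [h1, h2', h3, h4]
    push_cast
    field_simp
    ring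
  rw [Finset.mul_sum, Finset.mul_sum, Finset.mul_sum, ← Finset.sum_sub_distrib,
    ← Finset.sum_add_distrib, Finset.sum_congr rfl hG, Finset.sum_range_sub]
  simp [G]

/-! ### The same recurrence, up to powers of 9, for the hypergeometric series. -/

/-- The terms of the hypergeometric series for the even moments. -/
noncomputable def momentTerm (k m : ℕ) : ℝ :=
  ((k + m).factorial : ℝ) ^ 4 /
    ((k.factorial : ℝ) ^ 2 * (m.factorial : ℝ) ^ 2 * ((2 * k + 2 * m + 1).factorial : ℝ))

theorem momentTerm_pos (k m : ℕ) : 0 < momentTerm k m := by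
  unfold momentTerm; positivity

theorem momentTerm_succ_left (k m : ℕ) : momentTerm (k + 1) m =
    momentTerm k m * ((k + m + 1) ^ 3 / (2 * (k + 1) ^ 2 * (2 * k + 2 * m + 3))) := by
  unfold momentTerm
  rw [show k + 1 + m = k + m + 1 by ring, show 2 * (k + 1) + 2 * m + 1 = 2 * k + 2 * m + 1 + 1 + 1 by ring]
  simp only [Nat.factorial_succ]
  push_cast
  field_simp
  ring

theorem momentTerm_succ_right (k m : ℕ) : momentTerm k (m + 1) =
    momentTerm k m * ((k + m + 1) ^ 3 / (2 * (m + 1) ^ 2 * (2 * k + 2 * m + 3))) := by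
  unfold momentTerm
  rw [show k + (m + 1) = k + m + 1 by ring, show 2 * k + 2 * (m + 1) + 1 = 2 * k + 2 * m + 1 + 1 + 1 by ring]
  simp only [Nat.factorial_succ]
  push_cast
  field_simp
  ring

/-- The telescoping certificate for the recurrence of `∑ₘ momentTerm k m`. -/
noncomputable def momentCertificate (k m : ℕ) : ℝ :=
  momentTerm k m * (-(m : ℝ) ^ 2 * (243 + 1107 * k + 1755 * k ^ 2 + 1161 * k ^ 3 + 270 * k ^ 4 +
    (891 + 2718 * k + 2619 * k ^ 2 + 792 * k ^ 3) * m + (1017 + 1899 * k + 828 * k ^ 2) * m ^ 2 +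
    (441 + 360 * k) * m ^ 3 + 54 * m ^ 4) /
    (2 * (k + 1) ^ 2 * (2 * k + 2 * m + 1) * (2 * k + 2 * m + 3)))

/-- The coefficients are those of `threeStepMoment_recurrence` rescaled for the factor `9 ^ k`.
After dividing by `momentTerm k m` both sides are rational in `k` and `m`. -/
theorem momentTerm_telescope (k m : ℕ) :
    81 * ((k : ℝ) + 2) ^ 2 * momentTerm (k + 2) m
      - 9 * (10 * k ^ 2 + 30 * k + 23) * momentTerm (k + 1) m + 9 * (k + 1) ^ 2 * momentTerm k m =
      momentCertificate k (m + 1) - momentCertificate k m := by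
  unfold momentCertificate
  rw [momentTerm_succ_left (k + 1), momentTerm_succ_left k, momentTerm_succ_right k]
  push_cast
  field_simp
  ring

theorem momentTerm_zero_telescope (m : ℕ) :
    9 * momentTerm 1 m - 3 * momentTerm 0 m =
      -3 * ((m + 1 : ℕ) : ℝ) * ((m + 1 : ℕ) + 2) * momentTerm 0 (m + 1)
        - -3 * (m : ℝ) * (m + 2) * momentTerm 0 m := by
  rw [momentTerm_succ_left 0, momentTerm_succ_right 0]
  push_cast
  field_simp
  ring

/-- Consecutive terms have ratio tending to 1/4. The weight of degree 6 matches the numerator of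
`momentCertificate`, so that the certificate tends to 0. -/
theorem summable_pow_mul_momentTerm (k : ℕ) :
    Summable fun m : ℕ => ((m : ℝ) + 1) ^ 6 * momentTerm k m := by
  have hlim : Filter.Tendsto (fun m : ℕ => (1 / 4 : ℝ) * (1 + k * (1 / ((m : ℝ) + 1))) ^ 2 *
      (1 + 1 / ((m : ℝ) + 1)) ^ 6) Filter.atTop (nhds ((1 / 4 : ℝ) * (1 + k * 0) ^ 2 * (1 + 0) ^ 6)) := by
    have h := tendsto_one_div_add_atTop_nhds_zero_nat (𝕜 := ℝ)
    exact (((h.const_mul _).const_add 1).pow 2 |>.const_mul _).mul ((h.const_add 1).pow 6)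
  have hev := hlim.eventually_lt_const (show (1 / 4 : ℝ) * (1 + k * 0) ^ 2 * (1 + 0) ^ 6 < 1 / 2 by
    norm_num)
  refine summable_of_ratio_norm_eventually_le (r := 1 / 2) (by norm_num) ?_
  filter_upwards [hev] with m hm
  have ht := momentTerm_pos k m
  have ht' := momentTerm_pos k (m + 1)
  rw [Real.norm_of_nonneg (by positivity), Real.norm_of_nonneg (by positivity)]
  -- This is `(k + m + 1) / (2k + 2m + 3) ≤ 1/2`.
  have hr : ((k : ℝ) + m + 1) ^ 3 / (2 * (m + 1) ^ 2 * (2 * k + 2 * m + 3)) ≤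
      1 / 4 * (1 + k * (1 / ((m : ℝ) + 1))) ^ 2 := by
    have : (1 : ℝ) / 4 * (1 + k * (1 / ((m : ℝ) + 1))) ^ 2 =
        ((k : ℝ) + m + 1) ^ 2 / (4 * (m + 1) ^ 2) := by
      field_simp; ring
    rw [this, div_le_div_iff₀ (by positivity) (by positivity)]
    have h0 : (0 : ℝ) ≤ (k + m + 1) ^ 2 * (2 * (m + 1) ^ 2) := by positivity
    nlinarith
  have hy : ((m + 1 : ℕ) : ℝ) + 1 = (1 + 1 / ((m : ℝ) + 1)) * (m + 1) := by
    push_cast; field_simp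
  rw [momentTerm_succ_right, hy]
  calc ((1 + 1 / ((m : ℝ) + 1)) * (m + 1)) ^ 6 * (momentTerm k m *
        ((k + m + 1) ^ 3 / (2 * (m + 1) ^ 2 * (2 * k + 2 * m + 3))))
      ≤ ((1 + 1 / ((m : ℝ) + 1)) * (m + 1)) ^ 6 * (momentTerm k m *
        (1 / 4 * (1 + k * (1 / ((m : ℝ) + 1))) ^ 2)) := by gcongr
    _ = (1 / 4 * (1 + k * (1 / ((m : ℝ) + 1))) ^ 2 * (1 + 1 / ((m : ℝ) + 1)) ^ 6) *
        ((m + 1) ^ 6 * momentTerm k m) := by ring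
    _ ≤ 1 / 2 * ((m + 1) ^ 6 * momentTerm k m) := by gcongr

theorem summable_momentTerm (k : ℕ) : Summable (momentTerm k) := by
  refine (summable_pow_mul_momentTerm k).of_nonneg_of_le (fun m => (momentTerm_pos k m).le)
    fun m => le_mul_of_one_le_left (momentTerm_pos k m).le (one_le_pow₀ ?_)
  have : (0 : ℝ) ≤ m := m.cast_nonneg
  linarith

theorem tendsto_momentCertificate (k : ℕ) :
    Filter.Tendsto (momentCertificate k) Filter.atTop (nhds 0) := by
  -- `C` is the sum of the coefficients of the quartic in `m`, each power of `m` up to the fourth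
  -- being at most `(m + 1) ^ 4`.
  set C : ℝ := 243 + 1107 * k + 1755 * k ^ 2 + 1161 * k ^ 3 + 270 * k ^ 4 +
    (891 + 2718 * k + 2619 * k ^ 2 + 792 * k ^ 3) + (1017 + 1899 * k + 828 * k ^ 2) +
    (441 + 360 * k) + 54 with hC
  refine squeeze_zero_norm (fun m => ?_)
    (by simpa using (summable_pow_mul_momentTerm k).tendsto_atTop_zero.const_mul C)
  have ht := momentTerm_pos k m
  have hm : (0 : ℝ) ≤ m := m.cast_nonneg
  have h1 : (1 : ℝ) ≤ 2 * (k + 1) ^ 2 * (2 * k + 2 * m + 1) * (2 * k + 2 * m + 3) := by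
    have hk : (0 : ℝ) ≤ k := k.cast_nonneg
    have a1 : (1 : ℝ) ≤ 2 * (k + 1) ^ 2 := by nlinarith
    have a2 : (1 : ℝ) ≤ 2 * k + 2 * m + 1 := by linarith
    have a3 : (1 : ℝ) ≤ 2 * k + 2 * m + 3 := by linarith
    exact one_le_mul_of_one_le_of_one_le (one_le_mul_of_one_le_of_one_le a1 a2) a3
  have hM : (1 : ℝ) ≤ m + 1 := by linarith
  have e0 : (1 : ℝ) ≤ (m + 1) ^ 4 := one_le_pow₀ hM
  have e1 : (m : ℝ) ≤ (m + 1) ^ 4 := le_trans (by linarith) (le_self_pow₀ hM (by norm_num))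
  have e2 : (m : ℝ) ^ 2 ≤ (m + 1) ^ 4 :=
    le_trans (pow_le_pow_left₀ hm (by linarith) 2) (pow_le_pow_right₀ hM (by norm_num))
  have e3 : (m : ℝ) ^ 3 ≤ (m + 1) ^ 4 :=
    le_trans (pow_le_pow_left₀ hm (by linarith) 3) (pow_le_pow_right₀ hM (by norm_num))
  have e4 : (m : ℝ) ^ 4 ≤ (m + 1) ^ 4 := pow_le_pow_left₀ hm (by linarith) 4
  set M : ℝ := (m + 1) ^ 4 with hMdef
  have hnum : (m : ℝ) ^ 2 * (243 + 1107 * k + 1755 * k ^ 2 + 1161 * k ^ 3 + 270 * k ^ 4 +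
      (891 + 2718 * k + 2619 * k ^ 2 + 792 * k ^ 3) * m + (1017 + 1899 * k + 828 * k ^ 2) * m ^ 2 +
      (441 + 360 * k) * m ^ 3 + 54 * m ^ 4) ≤ (m + 1) ^ 2 *
      ((243 + 1107 * k + 1755 * k ^ 2 + 1161 * k ^ 3 + 270 * k ^ 4) * M +
      (891 + 2718 * k + 2619 * k ^ 2 + 792 * k ^ 3) * M + (1017 + 1899 * k + 828 * k ^ 2) * M +
      (441 + 360 * k) * M + 54 * M) := by
    gcongr
    · linarith
    · exact le_mul_of_one_le_right (by positivity) e0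
  unfold momentCertificate
  rw [norm_mul, Real.norm_of_nonneg ht.le, norm_div, neg_mul, norm_neg,
    Real.norm_of_nonneg (by positivity), Real.norm_of_nonneg (zero_le_one.trans h1)]
  calc _ ≤ momentTerm k m * ((m + 1) ^ 2 *
      ((243 + 1107 * k + 1755 * k ^ 2 + 1161 * k ^ 3 + 270 * k ^ 4) * M +
      (891 + 2718 * k + 2619 * k ^ 2 + 792 * k ^ 3) * M + (1017 + 1899 * k + 828 * k ^ 2) * M +
      (441 + 360 * k) * M + 54 * M)) := by
        gcongr
        exact (div_le_self (by positivity) h1).trans hnum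
    _ = C * ((m + 1) ^ 6 * momentTerm k m) := by rw [hC, hMdef]; ring

theorem tsum_telescope_of_tendsto_zero {f G : ℕ → ℝ} (hf : Summable f) (h : ∀ m, f m = G (m + 1) - G m)
    (hG : Filter.Tendsto G Filter.atTop (nhds 0)) : ∑' m, f m = -G 0 := by
  refine tendsto_nhds_unique hf.hasSum.tendsto_sum_nat ?_
  simp_rw [h, Finset.sum_range_sub]
  simpa using hG.sub_const (G 0)

theorem tsum_momentTerm_recurrence (k : ℕ) :
    81 * ((k : ℝ) + 2) ^ 2 * ∑' m, momentTerm (k + 2) m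
      - 9 * (10 * k ^ 2 + 30 * k + 23) * ∑' m, momentTerm (k + 1) m
      + 9 * (k + 1) ^ 2 * ∑' m, momentTerm k m = 0 := by
  have h2 := (summable_momentTerm (k + 2)).mul_left (81 * ((k : ℝ) + 2) ^ 2)
  have h1 := (summable_momentTerm (k + 1)).mul_left (9 * (10 * (k : ℝ) ^ 2 + 30 * k + 23))
  have h0 := (summable_momentTerm k).mul_left (9 * ((k : ℝ) + 1) ^ 2)
  rw [← tsum_mul_left, ← tsum_mul_left, ← tsum_mul_left, ← h2.tsum_sub h1,
    ← (h2.sub h1).tsum_add h0,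
    tsum_telescope_of_tendsto_zero ((h2.sub h1).add h0) (momentTerm_telescope k) (tendsto_momentCertificate k)]
  simp [momentCertificate]

theorem tsum_momentTerm_one : 9 * ∑' m, momentTerm 1 m = 3 * ∑' m, momentTerm 0 m := by
  have h1 := (summable_momentTerm 1).mul_left 9
  have h0 := (summable_momentTerm 0).mul_left 3
  rw [← sub_eq_zero, ← tsum_mul_left, ← tsum_mul_left, ← h1.tsum_sub h0]
  have hlim : Filter.Tendsto (fun m : ℕ => -3 * (m : ℝ) * (m + 2) * momentTerm 0 m)
      Filter.atTop (nhds 0) := by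
    refine squeeze_zero_norm (fun m => ?_)
      (by simpa using (summable_pow_mul_momentTerm 0).tendsto_atTop_zero.const_mul 3)
    have ht := momentTerm_pos 0 m
    have hm : (0 : ℝ) ≤ m := m.cast_nonneg
    have hM : (1 : ℝ) ≤ (m + 1) ^ 4 := one_le_pow₀ (by linarith)
    rw [norm_mul, neg_mul, neg_mul, norm_neg, Real.norm_of_nonneg (by positivity),
      Real.norm_of_nonneg ht.le, ← mul_assoc]
    gcongr ?_ * _
    nlinarith [mul_le_mul_of_nonneg_left hM (sq_nonneg ((m : ℝ) + 1))]
  rw [tsum_telescope_of_tendsto_zero (h1.sub h0) momentTerm_zero_telescope hlim]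
  simp

/-- The case `k = 0` is the normalization `h0`, and `k = 1` reduces to it by `tsum_momentTerm_one`;
the recurrences do the rest. -/
theorem threeStepMoment_eq_tsum
    (h0 : 3 * Real.sqrt 3 / (2 * Real.pi) * ∑' m, momentTerm 0 m = 1) (k : ℕ) :
    threeStepMoment k = 3 * Real.sqrt 3 / (2 * Real.pi) * 9 ^ k * ∑' m, momentTerm k m := by
  induction k using Nat.twoStepInduction with
  | zero => rw [pow_zero, mul_one, h0]; simp [threeStepMoment]
  | one =>
    rw [pow_one, mul_assoc, tsum_momentTerm_one, mul_left_comm, h0]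
    norm_num [threeStepMoment, Finset.sum_range_succ, Nat.centralBinom]
  | more k ih0 ih1 =>
    have hk : ((k : ℝ) + 2) ^ 2 ≠ 0 := by positivity
    have hr := tsum_momentTerm_recurrence k
    have hs := threeStepMoment_recurrence k
    rw [ih0, ih1] at hs
    refine mul_left_cancel₀ hk ?_
    linear_combination hs - 3 * Real.sqrt 3 / (2 * Real.pi) * 9 ^ k * hr

/-! ### Binomial series, Parseval and beta integrals. -/

/-- The coefficient `(a)ₙ / n!` of `zⁿ` in `(1 - z)⁻ᵃ`. -/
noncomputable def negBinomialCoeff (a : ℂ) (n : ℕ) : ℂ :=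
  (ascPochhammer ℂ n).eval a / (n.factorial : ℂ)

theorem choose_add_sub_one_eq_negBinomialCoeff (a : ℂ) (n : ℕ) :
    Ring.choose (a + n - 1) n = negBinomialCoeff a n := by
  have h := Ring.factorial_nsmul_multichoose_eq_ascPochhammer a n
  rw [Ring.multichoose_eq, Polynomial.ascPochhammer_smeval_eq_eval, nsmul_eq_mul] at h
  rw [negBinomialCoeff, ← h, mul_div_cancel_left₀]
  exact_mod_cast n.factorial_ne_zero

theorem hasSum_negBinomialCoeff (a : ℂ) {z : ℂ} (hz : ‖z‖ < 1) :
    HasSum (fun n => negBinomialCoeff a n * z ^ n) ((1 - z) ^ (-a)) := by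
  have h := (Complex.one_div_one_sub_cpow_hasFPowerSeriesOnBall_zero a).hasSum (y := z)
    (by simpa [← ENNReal.ofReal_one, Metric.eball_ofReal] using hz)
  simpa [choose_add_sub_one_eq_negBinomialCoeff, Complex.cpow_neg, mul_comm] using h

theorem summable_norm_negBinomialCoeff (a : ℂ) {r : ℝ} (hr0 : 0 ≤ r) (hr : r < 1) :
    Summable fun n => ‖negBinomialCoeff a n‖ * r ^ n := by
  have h := (Complex.one_div_one_sub_cpow_hasFPowerSeriesOnBall_zero a)
  have h' := FormalMultilinearSeries.summable_norm_apply _ (x := (r : ℂ))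
    (Metric.eball_subset_eball h.r_le
      (by simpa [← ENNReal.ofReal_one, Metric.eball_ofReal, abs_of_nonneg hr0] using hr))
  simpa [choose_add_sub_one_eq_negBinomialCoeff, abs_of_nonneg hr0, mul_comm] using h'

/-- The diagonal of the square of the absolutely convergent binomial series at `r = 1/2`. -/
theorem summable_norm_negBinomialCoeff_sq (a : ℂ) :
    Summable fun n => ‖negBinomialCoeff a n‖ ^ 2 * (1 / 4 : ℝ) ^ n := by
  have h := summable_norm_negBinomialCoeff a (r := 1 / 2) (by norm_num) (by norm_num)
  have h2 := (h.mul_of_nonneg h (fun n => by positivity) (fun n => by positivity)).comp_injective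
    (i := fun n : ℕ => (n, n)) fun m n hmn => by simpa using hmn
  refine h2.congr fun n => ?_
  simp only [Function.comp]
  rw [show (1 / 4 : ℝ) = 1 / 2 * (1 / 2) by norm_num, mul_pow]
  ring

/-- In the right half-plane the arguments of `w` and its conjugate cancel, so the principal
logarithm is additive on their product. -/
theorem ofReal_norm_sq_cpow {w : ℂ} (hw : 0 < w.re) (a : ℂ) :
    ((‖w‖ ^ 2 : ℝ) : ℂ) ^ a = w ^ a * ((starRingEnd ℂ) w) ^ a := by
  have h0 : w ≠ 0 := fun h => by simp [h] at hw
  have h0' : (starRingEnd ℂ) w ≠ 0 := by simpa using h0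
  have harg : w.arg ≠ Real.pi := fun h => by
    rw [Complex.arg_eq_pi_iff] at h; linarith [h.1]
  rw [← Complex.normSq_eq_norm_sq, ← Complex.mul_conj, Complex.cpow_def_of_ne_zero (mul_ne_zero h0 h0'),
    Complex.cpow_def_of_ne_zero h0, Complex.cpow_def_of_ne_zero h0', Complex.log_mul h0 h0',
    add_mul, Complex.exp_add]
  rw [Complex.arg_conj, if_neg harg]
  simp [Real.pi_pos, Real.pi_pos.le]

theorem integral_norm_one_sub_mul_unitExp_cpow (a : ℂ) {r : ℝ} (hr0 : 0 ≤ r) (hr : r < 1) :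
    ∫ t in Set.Icc (0 : ℝ) 1, ((‖1 - r * unitExp t‖ ^ 2 : ℝ) : ℂ) ^ (-a) =
      ∑' n, negBinomialCoeff a n ^ 2 * ((r ^ 2 : ℝ) : ℂ) ^ n := by
  have hs : Summable fun n => ‖negBinomialCoeff a n * (r : ℂ) ^ n‖ := by
    simpa [abs_of_nonneg hr0] using summable_norm_negBinomialCoeff a hr0 hr
  have h := integral_tsum_mul_tsum_conj hs hs
  have hn : ∀ t, ‖(r : ℂ) * unitExp t‖ < 1 := fun t => by
    simpa [norm_unitExp, abs_of_nonneg hr0] using hr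
  have hcong : ∀ t : ℝ, ((‖1 - r * unitExp t‖ ^ 2 : ℝ) : ℂ) ^ (-a) =
      (∑' n, negBinomialCoeff a n * (r : ℂ) ^ n * unitExp t ^ n) *
      (∑' n, negBinomialCoeff a n * (r : ℂ) ^ n * (starRingEnd ℂ) (unitExp t) ^ n) := by
    intro t
    have hre : 0 < (1 - r * unitExp t).re := by
      have := (Complex.re_le_norm (r * unitExp t)).trans_lt (hn t)
      rw [Complex.sub_re, Complex.one_re]; linarith
    rw [ofReal_norm_sq_cpow hre]
    congr 1
    · rw [← (hasSum_negBinomialCoeff a (hn t)).tsum_eq]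
      exact tsum_congr fun n => by ring
    · have hn' : ‖(starRingEnd ℂ) ((r : ℂ) * unitExp t)‖ < 1 := by
        rw [RCLike.norm_conj]; exact hn t
      rw [map_sub, map_one, ← (hasSum_negBinomialCoeff a hn').tsum_eq]
      exact tsum_congr fun n => by rw [map_mul, Complex.conj_ofReal]; ring
  simp_rw [hcong]
  rw [h]
  exact tsum_congr fun n => by push_cast; ring

theorem ofReal_mul_one_sub_cpow {u : ℝ} (hu : u ∈ Set.Icc (0 : ℝ) 1) (a : ℂ) :
    ((u * (1 - u) : ℝ) : ℂ) ^ a = (u : ℂ) ^ a * (1 - (u : ℂ)) ^ a := by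
  have h := Complex.mul_cpow_ofReal_nonneg hu.1 (sub_nonneg.2 hu.2) a
  push_cast at h ⊢
  exact h

theorem integrableOn_mul_one_sub_cpow {a : ℂ} (ha : 0 < a.re) :
    IntegrableOn (fun u : ℝ => ((u * (1 - u) : ℝ) : ℂ) ^ (a - 1)) (Set.Icc 0 1) := by
  have h := Complex.betaIntegral_convergent ha ha
  rw [intervalIntegrable_iff_integrableOn_Icc_of_le zero_le_one] at h
  exact h.congr_fun (fun u hu => (ofReal_mul_one_sub_cpow hu _).symm) measurableSet_Icc

theorem integral_mul_one_sub_cpow (a : ℂ) :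
    ∫ u in Set.Icc (0 : ℝ) 1, ((u * (1 - u) : ℝ) : ℂ) ^ (a - 1) = Complex.betaIntegral a a := by
  rw [Complex.betaIntegral, intervalIntegral.integral_of_le zero_le_one,
    ← integral_Icc_eq_integral_Ioc]
  exact setIntegral_congr_fun measurableSet_Icc fun u hu => ofReal_mul_one_sub_cpow hu _

/-- `|1 - √(u(1-u)) e^{2πit}|²`, as a function of `(u, t)`. -/
noncomputable def poissonDenominator (p : ℝ × ℝ) : ℝ :=
  ‖1 - (Real.sqrt (p.1 * (1 - p.1)) : ℂ) * unitExp p.2‖ ^ 2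

@[fun_prop]
theorem continuous_poissonDenominator : Continuous poissonDenominator := by
  unfold poissonDenominator
  fun_prop

/-- No restriction on `u` is needed: `Real.sqrt` is 0 on negative numbers. Hence the denominator
stays above 1/4 on the whole plane. -/
theorem sqrt_mul_one_sub_le (u : ℝ) : Real.sqrt (u * (1 - u)) ≤ 1 / 2 := by
  rw [Real.sqrt_le_left (by norm_num)]
  nlinarith [sq_nonneg (u - 1 / 2)]

theorem one_fourth_le_poissonDenominator (p : ℝ × ℝ) : 1 / 4 ≤ poissonDenominator p := by
  have h : 1 / 2 ≤ ‖1 - (Real.sqrt (p.1 * (1 - p.1)) : ℂ) * unitExp p.2‖ := by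
    have h1 := norm_sub_norm_le (1 : ℂ) ((Real.sqrt (p.1 * (1 - p.1)) : ℂ) * unitExp p.2)
    have h2 := sqrt_mul_one_sub_le p.1
    rw [norm_mul, norm_unitExp, norm_one, mul_one, Complex.norm_real,
      Real.norm_of_nonneg (Real.sqrt_nonneg _)] at h1
    linarith
  unfold poissonDenominator
  nlinarith

theorem poissonDenominator_pos (p : ℝ × ℝ) : 0 < poissonDenominator p :=
  lt_of_lt_of_le (by norm_num) (one_fourth_le_poissonDenominator p)

theorem norm_poissonDenominator_cpow_le {a : ℂ} (ha : 0 < a.re) (p : ℝ × ℝ) :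
    ‖((poissonDenominator p : ℝ) : ℂ) ^ (-a)‖ ≤ (1 / 4 : ℝ) ^ (-a.re) := by
  rw [Complex.norm_cpow_eq_rpow_re_of_pos (poissonDenominator_pos p), Complex.neg_re]
  exact Real.rpow_le_rpow_of_nonpos (by norm_num) (one_fourth_le_poissonDenominator p) (by linarith)

theorem integrable_poisson_beta {a : ℂ} (ha : 0 < a.re) :
    Integrable (fun p : ℝ × ℝ => ((p.1 * (1 - p.1) : ℝ) : ℂ) ^ (a - 1) *
      ((poissonDenominator p : ℝ) : ℂ) ^ (-a))
      ((volume.restrict (Set.Icc (0 : ℝ) 1)).prod (volume.restrict (Set.Icc (0 : ℝ) 1))) := by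
  have h1 := (integrableOn_mul_one_sub_cpow ha).comp_fst (volume.restrict (Set.Icc (0 : ℝ) 1))
  refine h1.mul_bdd (c := (1 / 4 : ℝ) ^ (-a.re)) ?_ ?_
  · exact (Measurable.pow_const (by fun_prop) _).aestronglyMeasurable
  · exact Filter.Eventually.of_forall fun p => norm_poissonDenominator_cpow_le ha p

/-- Parseval in `t` with radius `√(u(1-u))`, then a beta integral in `u` for each term. Since
`u(1-u) ≤ 1/4`, the interchange is dominated by `summable_norm_negBinomialCoeff_sq`. -/
theorem hasSum_poisson_beta {a : ℂ} (ha : 0 < a.re) :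
    HasSum (fun m : ℕ => negBinomialCoeff a m ^ 2 * Complex.betaIntegral (a + m) (a + m))
      (∫ p : ℝ × ℝ, ((p.1 * (1 - p.1) : ℝ) : ℂ) ^ (a - 1) * ((poissonDenominator p : ℝ) : ℂ) ^ (-a)
      ∂((volume.restrict (Set.Icc (0 : ℝ) 1)).prod (volume.restrict (Set.Icc (0 : ℝ) 1)))) := by
  rw [integral_prod _ (integrable_poisson_beta ha)]
  have hinner : ∀ u ∈ Set.Icc (0 : ℝ) 1, ∫ t in Set.Icc (0 : ℝ) 1,
      ((u * (1 - u) : ℝ) : ℂ) ^ (a - 1) * ((poissonDenominator (u, t) : ℝ) : ℂ) ^ (-a) =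
      ∑' m, negBinomialCoeff a m ^ 2 *
        (((u * (1 - u) : ℝ) : ℂ) ^ (a - 1) * ((u * (1 - u) : ℝ) : ℂ) ^ m) := by
    intro u hu
    have hq : 0 ≤ u * (1 - u) := mul_nonneg hu.1 (sub_nonneg.2 hu.2)
    have := integral_norm_one_sub_mul_unitExp_cpow a (Real.sqrt_nonneg (u * (1 - u)))
      ((sqrt_mul_one_sub_le u).trans_lt (by norm_num))
    rw [integral_const_mul]
    unfold poissonDenominator
    rw [this, Real.sq_sqrt hq, ← tsum_mul_left]
    exact tsum_congr fun m => by ring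
  rw [setIntegral_congr_fun measurableSet_Icc hinner]
  have hpow : ∀ m : ℕ, ∀ᵐ u : ℝ ∂(volume.restrict (Set.Icc (0 : ℝ) 1)),
      negBinomialCoeff a m ^ 2 * ((u * (1 - u) : ℝ) : ℂ) ^ (a + m - 1) = negBinomialCoeff a m ^ 2 *
        (((u * (1 - u) : ℝ) : ℂ) ^ (a - 1) * ((u * (1 - u) : ℝ) : ℂ) ^ m) := by
    intro m
    -- The endpoints are discarded because the exponent law for `cpow` is applied with a nonzero
    -- base.
    rw [← Measure.restrict_congr_set Ioo_ae_eq_Icc]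
    filter_upwards [ae_restrict_mem measurableSet_Ioo] with u hu
    have hq : 0 < u * (1 - u) := mul_pos hu.1 (sub_pos.2 hu.2)
    rw [← Complex.cpow_natCast (_ : ℂ) m, ← Complex.cpow_add _ _ (by exact_mod_cast hq.ne')]
    congr 2; ring
  have hre : ∀ m : ℕ, 0 < (a + m).re := fun m => by
    rw [Complex.add_re, Complex.natCast_re]; positivity
  have hint : ∀ m : ℕ, Integrable (fun u : ℝ => negBinomialCoeff a m ^ 2 *
      (((u * (1 - u) : ℝ) : ℂ) ^ (a - 1) * ((u * (1 - u) : ℝ) : ℂ) ^ m))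
      (volume.restrict (Set.Icc (0 : ℝ) 1)) := fun m =>
    ((integrableOn_mul_one_sub_cpow (hre m)).const_mul _).congr (hpow m)
  have hsum : Summable fun m : ℕ => ∫ u in Set.Icc (0 : ℝ) 1, ‖negBinomialCoeff a m ^ 2 *
      (((u * (1 - u) : ℝ) : ℂ) ^ (a - 1) * ((u * (1 - u) : ℝ) : ℂ) ^ m)‖ := by
    refine Summable.of_nonneg_of_le (fun m => integral_nonneg fun u => norm_nonneg _) (fun m => ?_)
      ((summable_norm_negBinomialCoeff_sq a).mul_right
        (∫ u in Set.Icc (0 : ℝ) 1, ‖((u * (1 - u) : ℝ) : ℂ) ^ (a - 1)‖))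
    rw [← integral_const_mul]
    refine setIntegral_mono_on (hint m).norm
      ((integrableOn_mul_one_sub_cpow ha).norm.const_mul _) measurableSet_Icc fun u hu => ?_
    have hq : 0 ≤ u * (1 - u) := mul_nonneg hu.1 (sub_nonneg.2 hu.2)
    have hq' : u * (1 - u) ≤ 1 / 4 := by nlinarith [sq_nonneg (u - 1 / 2)]
    rw [norm_mul, norm_mul, norm_pow, norm_pow, Complex.norm_real (u * (1 - u)),
      Real.norm_of_nonneg hq, mul_comm (‖_ ^ (a - 1)‖), ← mul_assoc]
    gcongr
  have := hasSum_integral_of_summable_integral_norm hint hsum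
  refine this.congr_fun fun m => ?_
  rw [← integral_congr_ae (hpow m), integral_const_mul, integral_mul_one_sub_cpow]

theorem betaIntegral_add_one_self (n : ℕ) : Complex.betaIntegral (n + 1) (n + 1) =
    (((n.factorial : ℝ) ^ 2 / ((2 * n + 1).factorial : ℝ) : ℝ) : ℂ) := by
  have hre : 0 < ((n : ℂ) + 1).re := by simp; positivity
  have h := Complex.Gamma_mul_Gamma_eq_betaIntegral hre hre
  rw [show (n : ℂ) + 1 + (n + 1) = ((2 * n + 1 : ℕ) : ℂ) + 1 by push_cast; ring,
    Complex.Gamma_nat_eq_factorial, Complex.Gamma_nat_eq_factorial] at h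
  have h0 : ((2 * n + 1).factorial : ℂ) ≠ 0 := by exact_mod_cast (2 * n + 1).factorial_ne_zero
  push_cast
  rw [eq_div_iff h0]
  linear_combination -h

theorem negBinomialCoeff_natCast_add_one (k m : ℕ) : negBinomialCoeff ((k : ℂ) + 1) m =
    (((k + m).factorial / (k.factorial * m.factorial) : ℝ) : ℂ) := by
  have h := congrArg (Nat.cast (R := ℂ)) (Nat.factorial_mul_ascFactorial k m)
  have hk : (k.factorial : ℂ) ≠ 0 := by exact_mod_cast k.factorial_ne_zero
  have hm : (m.factorial : ℂ) ≠ 0 := by exact_mod_cast m.factorial_ne_zero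
  have h2 := ascPochhammer_eval_cast (S := ℂ) m (k + 1)
  rw [ascPochhammer_nat_eq_ascFactorial] at h2
  push_cast at h h2
  rw [negBinomialCoeff, ← h2]
  push_cast
  rw [← h]
  field_simp

theorem negBinomialCoeff_sq_mul_betaIntegral (k m : ℕ) :
    negBinomialCoeff ((k : ℂ) + 1) m ^ 2 *
      Complex.betaIntegral ((k : ℂ) + 1 + m) ((k : ℂ) + 1 + m) = ((momentTerm k m : ℝ) : ℂ) := by
  rw [show (k : ℂ) + 1 + m = ((k + m : ℕ) : ℂ) + 1 by push_cast; ring, betaIntegral_add_one_self,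
    negBinomialCoeff_natCast_add_one, ← Complex.ofReal_pow, ← Complex.ofReal_mul, momentTerm]
  congr 1
  rw [mul_add]
  field_simp

theorem integral_mul_one_sub_pow (m : ℕ) :
    ∫ u in Set.Icc (0 : ℝ) 1, (u * (1 - u)) ^ m = momentTerm 0 m := by
  have h := integral_mul_one_sub_cpow ((m : ℂ) + 1)
  rw [betaIntegral_add_one_self] at h
  simp_rw [add_sub_cancel_right, Complex.cpow_natCast, ← Complex.ofReal_pow] at h
  rw [integral_complex_ofReal] at h
  rw [Complex.ofReal_injective h, momentTerm]
  have := m.factorial_ne_zero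
  simp only [zero_add, mul_zero, Nat.factorial_zero, Nat.cast_one]
  field_simp

theorem integral_inv_one_sub_mul_one_sub :
    ∫ u in Set.Icc (0 : ℝ) 1, (1 - u * (1 - u))⁻¹ = 2 * Real.pi / (3 * Real.sqrt 3) := by
  have h3 : (0 : ℝ) < Real.sqrt 3 := by positivity
  have h33 : Real.sqrt 3 ^ 2 = 3 := Real.sq_sqrt (by norm_num)
  have hpos : ∀ u : ℝ, 0 < 1 - u * (1 - u) := fun u => by nlinarith [sq_nonneg (u - 1 / 2)]
  have hder : ∀ u : ℝ, HasDerivAt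
      (fun u => 2 / Real.sqrt 3 * Real.arctan ((2 * u - 1) / Real.sqrt 3)) (1 - u * (1 - u))⁻¹ u := by
    intro u
    have h1 : HasDerivAt (fun u : ℝ => (2 * u - 1) / Real.sqrt 3) (2 * 1 / Real.sqrt 3) u :=
      (((hasDerivAt_id u).const_mul 2).sub_const 1).div_const _
    refine (h1.arctan.const_mul (2 / Real.sqrt 3)).congr_deriv ?_
    have := hpos u
    have h4 : (0 : ℝ) < 1 + ((2 * u - 1) / Real.sqrt 3) ^ 2 := by positivity
    have h5 : 1 + ((2 * u - 1) / Real.sqrt 3) ^ 2 = 4 / 3 * (1 - u * (1 - u)) := by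
      rw [div_pow, h33]; ring
    rw [h5]
    field_simp
    rw [h33]; ring
  have hcont : Continuous fun u : ℝ => (1 - u * (1 - u))⁻¹ :=
    Continuous.inv₀ (by fun_prop) fun u => (hpos u).ne'
  rw [integral_Icc_eq_integral_Ioc, ← intervalIntegral.integral_of_le zero_le_one,
    intervalIntegral.integral_eq_sub_of_hasDerivAt (fun u _ => hder u)
      (hcont.intervalIntegrable _ _)]
  have e1 : (2 * 1 - 1) / Real.sqrt 3 = (Real.sqrt 3)⁻¹ := by rw [inv_eq_one_div]; norm_num
  have e2 : (2 * 0 - 1) / Real.sqrt 3 = -(Real.sqrt 3)⁻¹ := by rw [inv_eq_one_div]; ring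
  rw [e1, e2, Real.arctan_neg, Real.arctan_inv_sqrt_three]
  field_simp
  norm_num

/-- The terms are the integrals of `(u(1-u))^m`, so the sum is the integral of a geometric series;
this fixes the normalizing constant of the law. -/
theorem tsum_momentTerm_zero : ∑' m, momentTerm 0 m = 2 * Real.pi / (3 * Real.sqrt 3) := by
  rw [← integral_inv_one_sub_mul_one_sub]
  have hint : ∀ m : ℕ, Integrable (fun u : ℝ => (u * (1 - u)) ^ m)
      (volume.restrict (Set.Icc (0 : ℝ) 1)) := fun m =>
    (Continuous.continuousOn (by fun_prop)).integrableOn_compact isCompact_Icc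
  have hnorm : ∀ m : ℕ, ∫ u in Set.Icc (0 : ℝ) 1, ‖(u * (1 - u)) ^ m‖ = momentTerm 0 m := by
    intro m
    rw [← integral_mul_one_sub_pow]
    refine setIntegral_congr_fun measurableSet_Icc fun u hu => ?_
    exact Real.norm_of_nonneg (pow_nonneg (mul_nonneg hu.1 (sub_nonneg.2 hu.2)) m)
  have h := hasSum_integral_of_summable_integral_norm hint
    (by simpa only [hnorm] using summable_momentTerm 0)
  simp_rw [integral_mul_one_sub_pow] at h
  rw [h.tsum_eq]
  refine setIntegral_congr_fun measurableSet_Icc fun u hu => ?_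
  exact tsum_geometric_of_lt_one (mul_nonneg hu.1 (sub_nonneg.2 hu.2))
    (by nlinarith [sq_nonneg (u - 1 / 2)])

theorem threeStepMoment_eq (k : ℕ) :
    threeStepMoment k = 3 * Real.sqrt 3 / (2 * Real.pi) * 9 ^ k * ∑' m, momentTerm k m := by
  refine threeStepMoment_eq_tsum ?_ k
  rw [tsum_momentTerm_zero]
  have := Real.pi_pos
  field_simp

/-! ### From beta values to hypergeometric terms. -/

theorem Gamma_add_natCast_eq {a : ℂ} (ha : 0 < a.re) (m : ℕ) :
    Complex.Gamma (a + m) = (ascPochhammer ℂ m).eval a * Complex.Gamma a := by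
  induction m with
  | zero => simp
  | succ m ih =>
    have h : a + m ≠ 0 := fun h => by
      have := congrArg Complex.re h
      simp at this
      linarith [(m.cast_nonneg : (0 : ℝ) ≤ m)]
    rw [Nat.cast_succ, ← add_assoc, Complex.Gamma_add_one _ h, ih, ascPochhammer_succ_eval]
    ring

theorem Gamma_two_mul_add_natCast_eq {a : ℂ} (ha : 0 < a.re) (m : ℕ) :
    Complex.Gamma (2 * (a + m)) = 4 ^ m * (ascPochhammer ℂ m).eval a *
      (ascPochhammer ℂ m).eval (a + 1 / 2) * Complex.Gamma (2 * a) := by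
  induction m with
  | zero => simp
  | succ m ih =>
    have hm : (0 : ℝ) ≤ m := m.cast_nonneg
    have h : 2 * (a + m) ≠ 0 := fun h => by
      have := congrArg Complex.re h
      simp at this
      linarith
    have h' : 2 * (a + m) + 1 ≠ 0 := fun h => by
      have := congrArg Complex.re h
      simp at this
      linarith
    rw [Nat.cast_succ, show 2 * (a + ((m : ℂ) + 1)) = 2 * (a + m) + 1 + 1 by ring,
      Complex.Gamma_add_one _ h', Complex.Gamma_add_one _ h, ih, ascPochhammer_succ_eval,
      ascPochhammer_succ_eval]
    ring

theorem ascPochhammer_eval_ne_zero_of_re_pos {a : ℂ} (ha : 0 < a.re) (m : ℕ) :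
    (ascPochhammer ℂ m).eval a ≠ 0 := by
  intro h
  have := Gamma_add_natCast_eq ha m
  rw [h, zero_mul] at this
  refine Complex.Gamma_ne_zero_of_re_pos ?_ this
  rw [Complex.add_re, Complex.natCast_re]; positivity

/-- With `B(a+m, a+m) = Γ(a+m)²/Γ(2a+2m)`, the duplication `(2a)₂ₘ = 4^m (a)ₘ (a+1/2)ₘ` cancels one
of four factors `(a)ₘ` and produces the argument 1/4; one of the two `m!` becomes `(1)ₘ`. -/
theorem negBinomialCoeff_sq_mul_betaIntegral_eq_hypergeometricTerm {a : ℂ} (ha : 0 < a.re)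
    (m : ℕ) : negBinomialCoeff a m ^ 2 * Complex.betaIntegral (a + m) (a + m) =
      Complex.Gamma a ^ 2 / Complex.Gamma (2 * a) *
        hypergeometricTerm [a, a, a] [1, a + 1 / 2] (1 / 4) m := by
  have hre : 0 < (a + m).re := by rw [Complex.add_re, Complex.natCast_re]; positivity
  have h := Complex.Gamma_mul_Gamma_eq_betaIntegral hre hre
  rw [← two_mul, Gamma_two_mul_add_natCast_eq ha, Gamma_add_natCast_eq ha] at h
  have h1 := ascPochhammer_eval_ne_zero_of_re_pos ha m
  have h2 : (ascPochhammer ℂ m).eval (a + 1 / 2) ≠ 0 :=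
    ascPochhammer_eval_ne_zero_of_re_pos (by simp; linarith) m
  have h3 : Complex.Gamma (2 * a) ≠ 0 := Complex.Gamma_ne_zero_of_re_pos (by simpa using ha)
  have hm : (m.factorial : ℂ) ≠ 0 := by exact_mod_cast m.factorial_ne_zero
  have hB : Complex.betaIntegral (a + m) (a + m) = (ascPochhammer ℂ m).eval a *
      Complex.Gamma a ^ 2 / (4 ^ m * (ascPochhammer ℂ m).eval (a + 1 / 2) * Complex.Gamma (2 * a)) := by
    rw [eq_div_iff (mul_ne_zero (mul_ne_zero (pow_ne_zero _ (by norm_num)) h2) h3)]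
    refine mul_left_cancel₀ h1 ?_
    linear_combination -h
  rw [hB, negBinomialCoeff, hypergeometricTerm]
  simp only [List.map_cons, List.map_nil, List.prod_cons, List.prod_nil, ascPochhammer_eval_one,
    one_div, inv_pow, mul_one]
  rw [one_div] at h2
  field_simp

theorem ofReal_cpow_eq_exp_log {x : ℝ} (hx : 0 < x) (s : ℂ) :
    (x : ℂ) ^ s = Complex.exp ((Real.log x : ℂ) * s) := by
  rw [Complex.cpow_def_of_ne_zero (by exact_mod_cast hx.ne'), Complex.ofReal_log hx.le]

/-! ### The explicit law and its complex moments. -/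

/-- The squared length of the walk in the parametrization by `(u, t)`. -/
noncomputable def poissonValue (p : ℝ × ℝ) : ℝ := 9 * (p.1 * (1 - p.1)) / poissonDenominator p

/-- The density of the parametrization by `(u, t)`. -/
noncomputable def poissonDensity (p : ℝ × ℝ) : ℝ :=
  3 * Real.sqrt 3 / (2 * Real.pi) / poissonDenominator p

@[fun_prop]
theorem continuous_poissonValue : Continuous poissonValue := by
  unfold poissonValue
  exact Continuous.div (by fun_prop) (by fun_prop) fun p => (poissonDenominator_pos p).ne'

@[fun_prop]
theorem continuous_poissonDensity : Continuous poissonDensity := by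
  unfold poissonDensity
  exact Continuous.div (by fun_prop) (by fun_prop) fun p => (poissonDenominator_pos p).ne'

theorem poissonDensity_pos (p : ℝ × ℝ) : 0 < poissonDensity p := by
  have := poissonDenominator_pos p
  unfold poissonDensity
  positivity

/-- The measure on the `(u, t)`-square with density `poissonDensity`. -/
noncomputable def poissonMeasure : Measure (ℝ × ℝ) :=
  ((volume.restrict (Set.Icc (0 : ℝ) 1)).prod (volume.restrict (Set.Icc (0 : ℝ) 1))).withDensity
    fun p => ENNReal.ofReal (poissonDensity p)

instance isFiniteMeasure_poissonMeasure : IsFiniteMeasure poissonMeasure := by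
  refine isFiniteMeasure_withDensity_ofReal (Integrable.hasFiniteIntegral ?_)
  refine Integrable.of_bound (by fun_prop) (3 * Real.sqrt 3 / (2 * Real.pi) / (1 / 4))
    (Filter.Eventually.of_forall fun p => ?_)
  rw [Real.norm_of_nonneg (poissonDensity_pos p).le, poissonDensity]
  gcongr
  exact one_fourth_le_poissonDenominator p

theorem ae_fst_mem_Ioo : ∀ᵐ p ∂((volume.restrict (Set.Icc (0 : ℝ) 1)).prod
    (volume.restrict (Set.Icc (0 : ℝ) 1))), p.1 ∈ Set.Ioo (0 : ℝ) 1 := by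
  refine Measure.quasiMeasurePreserving_fst.ae ?_
  rw [← Measure.restrict_congr_set Ioo_ae_eq_Icc]
  exact ae_restrict_mem measurableSet_Ioo

theorem ae_poissonValue_mem : ∀ᵐ p ∂poissonMeasure, poissonValue p ∈ Set.Ioc (0 : ℝ) 9 := by
  filter_upwards [(withDensity_absolutelyContinuous _ _).ae_le ae_fst_mem_Ioo] with p hp
  have hq : 0 < p.1 * (1 - p.1) := mul_pos hp.1 (sub_pos.2 hp.2)
  have hK := one_fourth_le_poissonDenominator p
  have hK' := poissonDenominator_pos p
  refine ⟨by unfold poissonValue; positivity, ?_⟩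
  rw [poissonValue, div_le_iff₀ hK']
  -- The upper bound 9 holds because `u(1-u) ≤ 1/4 ≤ poissonDenominator p`.
  nlinarith [sq_nonneg (p.1 - 1 / 2)]

/-- The extra `1/K` in the density turns the exponent `-s/2` of `K` into `-(1 + s/2)`, which makes
`hasSum_poisson_beta` applicable with `a = 1 + s/2`. -/
theorem poissonDensity_smul_sqrt_poissonValue_cpow {p : ℝ × ℝ} (hp : p.1 ∈ Set.Ioo (0 : ℝ) 1)
    (s : ℂ) : poissonDensity p • ((Real.sqrt (poissonValue p) : ℝ) : ℂ) ^ s =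
      ((3 * Real.sqrt 3 / (2 * Real.pi) : ℝ) : ℂ) * (3 : ℂ) ^ s *
        (((p.1 * (1 - p.1) : ℝ) : ℂ) ^ (1 + s / 2 - 1) *
          ((poissonDenominator p : ℝ) : ℂ) ^ (-(1 + s / 2))) := by
  have hq : 0 < p.1 * (1 - p.1) := mul_pos hp.1 (sub_pos.2 hp.2)
  have hK := poissonDenominator_pos p
  have hV : 0 < poissonValue p := by unfold poissonValue; positivity
  have h3 : (3 : ℂ) ^ s = Complex.exp ((Real.log 3 : ℂ) * s) := by
    rw [← ofReal_cpow_eq_exp_log (by norm_num : (0 : ℝ) < 3)]; norm_num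
  have hlog : Real.log (Real.sqrt (poissonValue p)) =
      Real.log 3 + Real.log (p.1 * (1 - p.1)) / 2 - Real.log (poissonDenominator p) / 2 := by
    rw [Real.log_sqrt hV.le, poissonValue, Real.log_div (by positivity) hK.ne',
      Real.log_mul (by norm_num) hq.ne', show (9 : ℝ) = 3 ^ 2 by norm_num, Real.log_pow]
    push_cast
    ring
  have hinv : ((poissonDenominator p : ℝ) : ℂ)⁻¹ =
      Complex.exp (-(Real.log (poissonDenominator p) : ℂ)) := by
    rw [Complex.exp_neg, ← Complex.ofReal_exp, Real.exp_log hK]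
  rw [ofReal_cpow_eq_exp_log (Real.sqrt_pos.2 hV), ofReal_cpow_eq_exp_log hq,
    ofReal_cpow_eq_exp_log hK, h3, hlog, Complex.real_smul, poissonDensity, Complex.ofReal_div _ (poissonDenominator p),
    div_eq_mul_inv, hinv, mul_assoc, mul_assoc, ← Complex.exp_add, ← Complex.exp_add,
    ← Complex.exp_add]
  congr 2
  push_cast
  ring

theorem integrable_sqrt_poissonValue_cpow {s : ℂ} (hs : -2 < s.re) :
    Integrable (fun p => ((Real.sqrt (poissonValue p) : ℝ) : ℂ) ^ s) poissonMeasure := by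
  have ha : 0 < (1 + s / 2).re := by simp; linarith
  rw [poissonMeasure, integrable_withDensity_iff_integrable_smul' (by fun_prop) (by simp)]
  refine ((integrable_poisson_beta ha).const_mul
    (((3 * Real.sqrt 3 / (2 * Real.pi) : ℝ) : ℂ) * (3 : ℂ) ^ s)).congr ?_
  filter_upwards [ae_fst_mem_Ioo] with p hp
  rw [ENNReal.toReal_ofReal (poissonDensity_pos p).le,
    poissonDensity_smul_sqrt_poissonValue_cpow hp]

theorem integral_sqrt_poissonValue_cpow (s : ℂ) :
    ∫ p, ((Real.sqrt (poissonValue p) : ℝ) : ℂ) ^ s ∂poissonMeasure =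
      ((3 * Real.sqrt 3 / (2 * Real.pi) : ℝ) : ℂ) * (3 : ℂ) ^ s *
      ∫ p : ℝ × ℝ, ((p.1 * (1 - p.1) : ℝ) : ℂ) ^ (1 + s / 2 - 1) *
        ((poissonDenominator p : ℝ) : ℂ) ^ (-(1 + s / 2))
      ∂((volume.restrict (Set.Icc (0 : ℝ) 1)).prod (volume.restrict (Set.Icc (0 : ℝ) 1))) := by
  rw [poissonMeasure, integral_withDensity_eq_integral_toReal_smul (by fun_prop) (by simp),
    ← integral_const_mul]
  refine integral_congr_ae ?_
  filter_upwards [ae_fst_mem_Ioo] with p hp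
  rw [ENNReal.toReal_ofReal (poissonDensity_pos p).le,
    poissonDensity_smul_sqrt_poissonValue_cpow hp]

theorem integral_poissonValue_pow (k : ℕ) :
    ∫ p, poissonValue p ^ k ∂poissonMeasure = threeStepMoment k := by
  have h := integral_sqrt_poissonValue_cpow (2 * k : ℕ)
  have ha : (1 : ℂ) + ((2 * k : ℕ) : ℂ) / 2 = k + 1 := by push_cast; ring
  have hre : 0 < ((k : ℂ) + 1).re := by simp; positivity
  have hsum := hasSum_poisson_beta hre
  simp_rw [negBinomialCoeff_sq_mul_betaIntegral] at hsum
  rw [ha, hsum.unique (Complex.hasSum_ofReal.2 (summable_momentTerm k).hasSum)] at h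
  have hcong : ∀ᵐ p ∂poissonMeasure, ((Real.sqrt (poissonValue p) : ℝ) : ℂ) ^ ((2 * k : ℕ) : ℂ) =
      ((poissonValue p ^ k : ℝ) : ℂ) := by
    filter_upwards [ae_poissonValue_mem] with p hp
    rw [Complex.cpow_natCast, pow_mul, ← Complex.ofReal_pow, Real.sq_sqrt hp.1.le,
      Complex.ofReal_pow]
  rw [integral_congr_ae hcong, integral_complex_ofReal] at h
  apply Complex.ofReal_injective
  rw [h, threeStepMoment_eq, Complex.cpow_natCast, pow_mul]
  push_cast
  norm_num

/-- The law of the squared length of a three-step planar random walk. -/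
noncomputable def threeStepLaw : Measure ℝ := poissonMeasure.map poissonValue

theorem aemeasurable_poissonValue : AEMeasurable poissonValue poissonMeasure := by fun_prop

theorem ae_threeStepLaw_mem : ∀ᵐ v ∂threeStepLaw, v ∈ Set.Ioc (0 : ℝ) 9 := by
  exact (ae_map_iff aemeasurable_poissonValue measurableSet_Ioc).2 ae_poissonValue_mem

instance isFiniteMeasure_threeStepLaw : IsFiniteMeasure threeStepLaw := by
  unfold threeStepLaw; infer_instance

/-- A bounded random variable with the moments of the three-step walk has its law. -/
theorem map_eq_threeStepLaw {Ω : Type*} [MeasurableSpace Ω] {μ : Measure Ω} [IsFiniteMeasure μ]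
    {f : Ω → ℝ} (hf : Measurable f) (hmem : ∀ ω, f ω ∈ Set.Icc (0 : ℝ) 9)
    (hmom : ∀ k : ℕ, ∫ ω, f ω ^ k ∂μ = threeStepMoment k) : μ.map f = threeStepLaw := by
  refine Measure.ext_of_integral_pow_eq (a := 0) (b := 9) ?_
    (ae_threeStepLaw_mem.mono fun v hv => ⟨hv.1.le, hv.2⟩) fun k => ?_
  · exact (ae_map_iff hf.aemeasurable measurableSet_Icc).2 (Filter.Eventually.of_forall hmem)
  · rw [integral_map hf.aemeasurable (by fun_prop), hmom, threeStepLaw,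
      integral_map aemeasurable_poissonValue (by fun_prop), integral_poissonValue_pow]

theorem measurable_sqrt_cpow (s : ℂ) : Measurable fun v : ℝ => ((Real.sqrt v : ℝ) : ℂ) ^ s :=
  Measurable.pow_const (by fun_prop) _

theorem integrable_threeStepLaw_sqrt_cpow {s : ℂ} (hs : -2 < s.re) :
    Integrable (fun v : ℝ => ((Real.sqrt v : ℝ) : ℂ) ^ s) threeStepLaw := by
  rw [threeStepLaw, integrable_map_measure (measurable_sqrt_cpow s).aestronglyMeasurable
    aemeasurable_poissonValue]
  exact integrable_sqrt_poissonValue_cpow hs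

theorem hasSum_threeStepLaw_hypergeometricTerm {s : ℂ} (hs : -2 < s.re) :
    HasSum (fun m => ((3 * Real.sqrt 3 / (2 * Real.pi) : ℝ) : ℂ) * (3 : ℂ) ^ s *
      (Complex.Gamma (1 + s / 2) ^ 2 / Complex.Gamma (s + 2) *
        hypergeometricTerm [(s + 2) / 2, (s + 2) / 2, (s + 2) / 2] [1, (s + 3) / 2] (1 / 4) m))
      (∫ v, ((Real.sqrt v : ℝ) : ℂ) ^ s ∂threeStepLaw) := by
  have ha : 0 < (1 + s / 2).re := by simp; linarith
  have h := hasSum_poisson_beta ha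
  simp_rw [negBinomialCoeff_sq_mul_betaIntegral_eq_hypergeometricTerm ha] at h
  rw [threeStepLaw, integral_map aemeasurable_poissonValue
    (measurable_sqrt_cpow s).aestronglyMeasurable, integral_sqrt_poissonValue_cpow,
    show s + 2 = 2 * (1 + s / 2) by ring, show (s + 3) / 2 = 1 + s / 2 + 1 / 2 by ring,
    mul_div_cancel_left₀ _ (two_ne_zero' ℂ)]
  exact h.mul_left _

/-! ### Logarithmic moments and the exponential generating function. -/

theorem measurable_log_sqrt_pow (m : ℕ) : Measurable fun v : ℝ => Real.log (Real.sqrt v) ^ m :=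
  (Real.measurable_log.comp Real.continuous_sqrt.measurable).pow_const m

/-- With `L = log √v`, `exp(c|L|) ≤ exp(cL) + exp(-cL)`, the moments of order `c` and `-c`; the
second is where `c < 2` enters. -/
theorem integrable_exp_mul_abs_log (c : ℝ) (hc0 : 0 ≤ c) (hc : c < 2) :
    Integrable (fun v => Real.exp (c * |Real.log (Real.sqrt v)|)) threeStepLaw := by
  have h1 := (integrable_threeStepLaw_sqrt_cpow (s := (c : ℂ)) (by simp; linarith)).norm
  have h2 := (integrable_threeStepLaw_sqrt_cpow (s := ((-c : ℝ) : ℂ)) (by simp; linarith)).norm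
  have hm : Measurable fun v : ℝ => Real.log (Real.sqrt v) := by
    simpa using measurable_log_sqrt_pow 1
  refine (h1.add h2).mono' (hm.abs.const_mul c).exp.aestronglyMeasurable ?_
  filter_upwards [ae_threeStepLaw_mem] with v hv
  have hv' := Real.sqrt_pos.2 hv.1
  rw [Pi.add_apply, ofReal_cpow_eq_exp_log hv', ofReal_cpow_eq_exp_log hv', ← Complex.ofReal_mul,
    ← Complex.ofReal_mul, Complex.norm_exp_ofReal, Complex.norm_exp_ofReal,
    Real.norm_of_nonneg (Real.exp_pos _).le]
  rcases abs_cases (Real.log (Real.sqrt v)) with ⟨h, _⟩ | ⟨h, _⟩ <;> rw [h]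
  · rw [mul_comm c]; exact le_add_of_nonneg_right (Real.exp_pos _).le
  · rw [show c * -Real.log (Real.sqrt v) = Real.log (Real.sqrt v) * -c by ring]
    exact le_add_of_nonneg_left (Real.exp_pos _).le

theorem integrable_log_sqrt_pow (m : ℕ) :
    Integrable (fun v => Real.log (Real.sqrt v) ^ m) threeStepLaw := by
  refine ((integrable_exp_mul_abs_log 1 zero_le_one one_lt_two).const_mul (m.factorial : ℝ)).mono'
    (measurable_log_sqrt_pow m).aestronglyMeasurable (Filter.Eventually.of_forall fun v => ?_)
  have h := Real.pow_div_factorial_le_exp _ (abs_nonneg (Real.log (Real.sqrt v))) m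
  rw [div_le_iff₀ (by positivity)] at h
  rw [norm_pow, Real.norm_eq_abs, one_mul, mul_comm]
  exact h

theorem hasSum_integral_log_sqrt_pow {s : ℂ} (hs : ‖s‖ < 2) :
    HasSum (fun m : ℕ => ((∫ v, Real.log (Real.sqrt v) ^ m ∂threeStepLaw : ℝ) : ℂ) *
      (s ^ m / (m.factorial : ℂ))) (∫ v, ((Real.sqrt v : ℝ) : ℂ) ^ s ∂threeStepLaw) := by
  have hterm : ∀ m : ℕ, ((∫ v, Real.log (Real.sqrt v) ^ m ∂threeStepLaw : ℝ) : ℂ) *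
      (s ^ m / (m.factorial : ℂ)) =
      ∫ v, ((Real.log (Real.sqrt v) : ℝ) : ℂ) ^ m * (s ^ m / (m.factorial : ℂ)) ∂threeStepLaw := by
    intro m
    rw [integral_mul_const, ← integral_complex_ofReal]
    push_cast
    rfl
  simp_rw [hterm]
  have hexp : ∀ v : ℝ, HasSum
      (fun m : ℕ => (‖s‖ * |Real.log (Real.sqrt v)|) ^ m / (m.factorial : ℝ))
      (Real.exp (‖s‖ * |Real.log (Real.sqrt v)|)) := fun v => by
    rw [Real.exp_eq_exp_ℝ]; exact NormedSpace.expSeries_div_hasSum_exp _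
  refine hasSum_integral_of_dominated_convergence
    (fun m v => (‖s‖ * |Real.log (Real.sqrt v)|) ^ m / (m.factorial : ℝ)) ?_ ?_ ?_ ?_ ?_
  · intro m
    exact (Measurable.mul_const (Measurable.pow_const (by fun_prop) _) _).aestronglyMeasurable
  · intro m
    refine Filter.Eventually.of_forall fun v => ?_
    rw [norm_mul, norm_pow, norm_div, norm_pow, Complex.norm_real, Complex.norm_natCast,
      Real.norm_eq_abs, mul_pow]
    exact le_of_eq (by ring)
  · exact Filter.Eventually.of_forall fun v => (hexp v).summable
  · simp_rw [(hexp _).tsum_eq]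
    exact integrable_exp_mul_abs_log _ (norm_nonneg s) hs
  -- Positivity of `v` matters: at `v = 0` the conventions `log 0 = 0` and `0 ^ s = 0` for `s ≠ 0`
  -- contradict the exponential series.
  · filter_upwards [ae_threeStepLaw_mem] with v hv
    rw [ofReal_cpow_eq_exp_log (Real.sqrt_pos.2 hv.1), Complex.exp_eq_exp_ℂ]
    refine (NormedSpace.expSeries_div_hasSum_exp
      ((Real.log (Real.sqrt v) : ℂ) * s)).congr_fun fun m => ?_
    rw [mul_pow, mul_div_assoc]

/-! ### Transfer from the explicit law to the torus. -/

theorem continuous_torusPoint_apply {n : ℕ} (j : Fin n) :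
    Continuous fun t : Fin n → ℝ => torusPoint t j := by
  unfold torusPoint; fun_prop

theorem norm_torusPoint_apply {n : ℕ} (t : Fin n → ℝ) (j : Fin n) : ‖torusPoint t j‖ = 1 :=
  norm_unitExp (t j)

theorem map_norm_one_add_torusPoint :
    (volume.restrict (Set.Icc (0 : Fin 2 → ℝ) 1)).map
      (fun t => ‖1 + torusPoint t 0 + torusPoint t 1‖ ^ 2) = threeStepLaw := by
  have : IsFiniteMeasure (volume.restrict (Set.Icc (0 : Fin 2 → ℝ) 1)) :=
    isFiniteMeasure_restrict.2 isCompact_Icc.measure_lt_top.ne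
  have hc := continuous_torusPoint_apply (n := 2)
  refine map_eq_threeStepLaw (Continuous.measurable (by fun_prop)) (fun t => ⟨by positivity, ?_⟩)
    integral_norm_one_add_torusPoint_pow
  have h := norm_add₃_le (a := (1 : ℂ)) (b := torusPoint t 0) (c := torusPoint t 1)
  rw [norm_torusPoint_apply, norm_torusPoint_apply, norm_one] at h
  nlinarith [norm_nonneg (1 + torusPoint t 0 + torusPoint t 1)]

theorem map_norm_sum_torusPoint :
    (volume.restrict (Set.Icc (0 : Fin 3 → ℝ) 1)).map
      (fun t => ‖∑ j, torusPoint t j‖ ^ 2) = threeStepLaw := by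
  have : IsFiniteMeasure (volume.restrict (Set.Icc (0 : Fin 3 → ℝ) 1)) :=
    isFiniteMeasure_restrict.2 isCompact_Icc.measure_lt_top.ne
  have hc := continuous_torusPoint_apply (n := 3)
  refine map_eq_threeStepLaw (Continuous.measurable (by fun_prop)) (fun t => ⟨by positivity, ?_⟩)
    integral_norm_sum_torusPoint_pow
  have h := norm_sum_le Finset.univ fun j => torusPoint t j
  simp only [norm_torusPoint_apply, Finset.sum_const, Finset.card_univ, Fintype.card_fin,
    nsmul_eq_mul] at h
  push_cast at h
  nlinarith [norm_nonneg (∑ j, torusPoint t j)]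

theorem mahlerIntegrand_one_add_eq (m : ℕ) (t : Fin 2 → ℝ) :
    mahlerIntegrand (fun (_ : Fin m) (z : Fin 2 → ℂ) => 1 + z 0 + z 1) t =
      Real.log (Real.sqrt (‖1 + torusPoint t 0 + torusPoint t 1‖ ^ 2)) ^ m := by
  rw [Real.sqrt_sq (norm_nonneg _)]
  simp [mahlerIntegrand]

theorem walkIntegrand_three_eq (s : ℂ) (t : Fin 3 → ℝ) :
    walkIntegrand 3 s t = ((Real.sqrt (‖∑ j, torusPoint t j‖ ^ 2) : ℝ) : ℂ) ^ s := by
  rw [Real.sqrt_sq (norm_nonneg _), walkIntegrand]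

theorem higherMahlerMeasure_one_add_eq (m : ℕ) :
    higherMahlerMeasure m (fun z : Fin 2 → ℂ => 1 + z 0 + z 1) =
      ∫ v, Real.log (Real.sqrt v) ^ m ∂threeStepLaw := by
  have hc := continuous_torusPoint_apply (n := 2)
  rw [← map_norm_one_add_torusPoint, integral_map (Continuous.aemeasurable (by fun_prop))
    (measurable_log_sqrt_pow m).aestronglyMeasurable]
  simp_rw [higherMahlerMeasure, multipleMahlerMeasure, mahlerIntegrand_one_add_eq]

theorem walkMoment_three_eq (s : ℂ) :
    walkMoment 3 s = ∫ v, ((Real.sqrt v : ℝ) : ℂ) ^ s ∂threeStepLaw := by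
  have hc := continuous_torusPoint_apply (n := 3)
  rw [← map_norm_sum_torusPoint, integral_map (Continuous.aemeasurable (by fun_prop))
    (measurable_sqrt_cpow s).aestronglyMeasurable]
  simp_rw [walkMoment, walkIntegrand_three_eq]

theorem mainTheorem9 :
    -- the integrals that define the numbers `μₘ(1 + x + y)` converge absolutely
    (∀ m : ℕ, IntegrableOn
        (mahlerIntegrand (fun (_ : Fin m) (z : Fin 2 → ℂ) => 1 + z 0 + z 1))
        (Set.Icc (0 : Fin 2 → ℝ) 1)) ∧
    ∀ s : ℂ, ‖s‖ < 2 →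
      -- the integral that defines `W₃(s)` converges absolutely
      IntegrableOn (walkIntegrand 3 s) (Set.Icc (0 : Fin 3 → ℝ) 1) ∧
      HasSum
        (fun m : ℕ =>
          ((higherMahlerMeasure m (fun z : Fin 2 → ℂ => 1 + z 0 + z 1) : ℝ) : ℂ)
            * (s ^ m / (m.factorial : ℂ)))
        (walkMoment 3 s) ∧
      -- the hypergeometric series converges
      Summable (hypergeometricTerm [(s + 2) / 2, (s + 2) / 2, (s + 2) / 2]
        [1, (s + 3) / 2] (1 / 4)) ∧
      walkMoment 3 s =
        ((Real.sqrt 3 : ℝ) : ℂ) / (2 * (Real.pi : ℂ)) * (3 : ℂ) ^ (s + 1)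
          * (Complex.Gamma (1 + s / 2) ^ 2 / Complex.Gamma (s + 2))
          * generalizedHypergeometric [(s + 2) / 2, (s + 2) / 2, (s + 2) / 2]
              [1, (s + 3) / 2] (1 / 4) := by
  refine ⟨fun m => ?_, fun s hs => ?_⟩
  · have hc := continuous_torusPoint_apply (n := 2)
    have h := integrable_log_sqrt_pow m
    rw [← map_norm_one_add_torusPoint, integrable_map_measure
      (measurable_log_sqrt_pow m).aestronglyMeasurable (Continuous.aemeasurable (by fun_prop))] at h
    exact h.congr (Filter.Eventually.of_forall fun t => (mahlerIntegrand_one_add_eq m t).symm)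
  have hre : -2 < s.re := by
    have := (abs_lt.1 ((Complex.abs_re_le_norm s).trans_lt hs)).1
    linarith
  have hC : ((3 * Real.sqrt 3 / (2 * Real.pi) : ℝ) : ℂ) ≠ 0 := by
    have := Real.pi_pos
    exact_mod_cast (by positivity : 3 * Real.sqrt 3 / (2 * Real.pi) ≠ 0)
  have h3 : (3 : ℂ) ^ s ≠ 0 := by simp [Complex.cpow_eq_zero_iff]
  -- Nonvanishing prefactors can be divided out, so summability passes to the bare hypergeometric
  -- terms.
  have hG : Complex.Gamma (1 + s / 2) ^ 2 / Complex.Gamma (s + 2) ≠ 0 :=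
    div_ne_zero (pow_ne_zero _ (Complex.Gamma_ne_zero_of_re_pos (by simp; linarith)))
      (Complex.Gamma_ne_zero_of_re_pos (by simp; linarith))
  have hsum := hasSum_threeStepLaw_hypergeometricTerm hre
  refine ⟨?_, ?_, ?_, ?_⟩
  · have hc := continuous_torusPoint_apply (n := 3)
    have h := integrable_threeStepLaw_sqrt_cpow hre
    rw [← map_norm_sum_torusPoint, integrable_map_measure
      (measurable_sqrt_cpow s).aestronglyMeasurable (Continuous.aemeasurable (by fun_prop))] at h
    exact h.congr (Filter.Eventually.of_forall fun t => (walkIntegrand_three_eq s t).symm)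
  · simp_rw [higherMahlerMeasure_one_add_eq, walkMoment_three_eq]
    exact hasSum_integral_log_sqrt_pow hs
  · exact (summable_mul_left_iff hG).1 ((summable_mul_left_iff (mul_ne_zero hC h3)).1 hsum.summable)
  · rw [walkMoment_three_eq, ← hsum.tsum_eq, tsum_mul_left, tsum_mul_left,
      generalizedHypergeometric, Complex.cpow_add _ _ three_ne_zero, Complex.cpow_one]
    push_cast
    ring
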